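/- Let $\lambda_1,\lambda_2,\lambda_3,\mu_1,\mu_2,\mu_3\in\mathbb{C}$ with $\sum\lambda_i=\sum\mu_i$, and put $$\theta_1=\lambda_1-\mu_1,\quad \theta_2=\lambda_2-\mu_1,\quad \theta_3=\lambda_3-\mu_1,\quad \theta_4=\mu_3-\mu_2 .$$ Let $U\subset\mathbb{C}\setminus\{0,1\}$ be open and let $y$ be a holomorphic function on $U$, with $y(t)\notin\{0,1,t\}$ for all $t\in U$, which solves the Painlevé VI equation $$y''=\tfrac12\Bigl(\tfrac1y+\tfrac1{y-1}+\tfrac1{y-t}\Bigr)(y')^2-\Bigl(\tfrac1t+\tfrac1{t-1}+\tfrac1{y-t}\Bigr)y'+\tfrac{y(y-1)(y-t)}{t^2(t-1)^2}\Bigl(\alpha+\beta\tfrac{t}{y^2}+\gamma\tfrac{t-1}{(y-1)^2}+\delta\tfrac{t(t-1)}{(y-t)^2}\Bigr)$$ with $\alpha=(\theta_4-1)^2/2$, $\beta=-\theta_1^2/2$, $\gamma=\theta_3^2/2$, $\delta=(1-\theta_2^2)/2$. Define $$x=\frac12\left(\frac{(t-1)y'-\theta_1}{y}+\frac{y'-1-\theta_2}{y-t}-\frac{t\,y'+\theta_3}{y-1}\right)$$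 and $$B_1=\begin{pmatrix}\lambda_1&b_{12}&b_{13}\\0&0&0\\0&0&0\end{pmatrix},\quad B_2=\begin{pmatrix}0&0&0\\b_{21}&\lambda_2&b_{23}\\0&0&0\end{pmatrix},\quad B_3=\begin{pmatrix}0&0&0\\0&0&0\\b_{31}&b_{32}&\lambda_3\end{pmatrix},$$ where $$b_{12}=\lambda_1-\mu_3y+(\mu_1-xy)(y-1),\qquad b_{13}=\lambda_1t-\mu_3y+(\mu_1-xy)(y-t),$$ $$b_{21}=\lambda_2+\frac{\mu_3(y-t)-\mu_1(y-1)+x(y-t)(y-1)}{t-1},$$ $$b_{32}=(\mu_2-\lambda_2-b_{12})/t,\qquad b_{23}=(\mu_2-\lambda_3)t-b_{13},\qquad b_{31}=(\mu_2-\lambda_1-b_{21})/t .$$ Then for every $t\in U$ the matrix $B_i(t)$ has trace $\lambda_i$ and rank at most one, and it has rank exactly one if $\lambda_i\neq0$ or $\mu_3\neq0$; the sum $B_1+B_2+B_3$ has eigenvalues $\mu_1,\mu_2,\mu_3$ (with multiplicity). Moreover the family of logarithmic connections $$\nabla_t=d-\left(\frac{B_1(t)}{z}+\frac{B_2(t)}{z-t}+\frac{B_3(t)}{z-1}\right)dz,\qquad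 t\in U,$$ on the trivial rank three bundle over $\mathbb{P}^1$ is isomonodromic: for every open disc $V\subset U$, all $t,t'\in V$ and every base point $z_0\in\mathbb{C}\setminus(V\cup\{0,1\})$ there is $C\in\mathrm{GL}_3(\mathbb{C})$ such that, for every loop $\gamma$ in $\mathbb{C}\setminus(V\cup\{0,1\})$ based at $z_0$, the monodromy matrices $M_\gamma(t)$ and $M_\gamma(t')$ of $\nabla_t$ and $\nabla_{t'}$ along $\gamma$ satisfy $M_\gamma(t')=C\,M_\gamma(t)\,C^{-1}$. (Here $M_\gamma(t)$ is the value at the end of $\gamma$ of the analytic continuation along $\gamma$ of the matrix solution $\Phi$ of $\nabla_t\Phi=0$ with $\Phi(z_0)=1$.) -/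

import Mathlib

open Topology

noncomputable section

/-- `y` is a holomorphic solution, on the set `U`, of the sixth Painlevé equation with parameters
`θ = (θ₁, θ₂, θ₃, θ₄)`, that is with constants `α = (θ₄ - 1)² / 2`, `β = -θ₁² / 2`, `γ = θ₃² / 2`,
`δ = (1 - θ₂²) / 2`. The equation has denominators `y`, `y - 1`, `y - t`, which are required not
to vanish on `U`; `U` is meant to be an open subset of `ℂ \ {0, 1}`. -/
def SolvesPVI (θ : Fin 4 → ℂ) (U : Set ℂ) (y : ℂ → ℂ) : Prop :=
  DifferentiableOn ℂ y U ∧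
  ∀ t ∈ U, y t ≠ 0 ∧ y t ≠ 1 ∧ y t ≠ t ∧
    deriv (deriv y) t =
      1 / 2 * (1 / y t + 1 / (y t - 1) + 1 / (y t - t)) * deriv y t ^ 2
      - (1 / t + 1 / (t - 1) + 1 / (y t - t)) * deriv y t
      + y t * (y t - 1) * (y t - t) / (t ^ 2 * (t - 1) ^ 2) *
        ((θ 3 - 1) ^ 2 / 2
          + -(θ 0 ^ 2) / 2 * (t / y t ^ 2)
          + θ 2 ^ 2 / 2 * ((t - 1) / (y t - 1) ^ 2)
          + (1 - θ 1 ^ 2) / 2 * (t * (t - 1) / (y t - t) ^ 2))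

/-- `Y` is the analytic continuation along the path `γ` of a holomorphic matrix solution of
`dΦ/dz = A Φ`: near each parameter `s`, `Y` is the restriction to `γ` of a local solution. -/
def IsContinuation (A : ℂ → Matrix (Fin 3) (Fin 3) ℂ) {z₀ z₁ : ℂ} (γ : Path z₀ z₁)
    (Y : unitInterval → Matrix (Fin 3) (Fin 3) ℂ) : Prop :=
  ∀ s : unitInterval, ∃ Φ : ℂ → Matrix (Fin 3) (Fin 3) ℂ,
    (∀ᶠ z in 𝓝 (γ s), ∀ i j, HasDerivAt (fun w => Φ w i j) ((A z * Φ z) i j) z) ∧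
    ∀ᶠ s' in 𝓝 s, Y s' = Φ (γ s')

/-- `M` is the monodromy matrix along the loop `γ` of the connection `d - A dz`: the fundamental
solution that is the identity at the base point is continued along `γ` to the value `M`. -/
def IsMonodromy (A : ℂ → Matrix (Fin 3) (Fin 3) ℂ) {z₀ : ℂ} (γ : Path z₀ z₀)
    (M : Matrix (Fin 3) (Fin 3) ℂ) : Prop :=
  ∃ Y : unitInterval → Matrix (Fin 3) (Fin 3) ℂ, IsContinuation A γ Y ∧ Y 0 = 1 ∧ Y 1 = M

/-- The matrix `A = B₁ / z + B₂ / (z - t) + B₃ / (z - 1)` of the logarithmic connection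
`d - A dz` with poles `0, t, 1` (and `∞`). -/
def logMatrix (B : Fin 3 → Matrix (Fin 3) (Fin 3) ℂ) (t z : ℂ) : Matrix (Fin 3) (Fin 3) ℂ :=
  (1 / z) • B 0 + (1 / (z - t)) • B 1 + (1 / (z - 1)) • B 2

/-- The family of connections `d - (B₁(t) / z + B₂(t) / (z - t) + B₃(t) / (z - 1)) dz`, `t ∈ U`,
is isomonodromic: the conjugacy class of the monodromy representation is locally constant in `t`.
While `t` stays in a disc `V ⊆ U`, the fundamental groups of the punctured spheres are
identified by using the same loops, namely loops that avoid `V` and the fixed poles `0, 1`.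
One matrix `C` has to conjugate the monodromies along all these loops simultaneously. -/
def IsIsomonodromic (U : Set ℂ) (B : ℂ → Fin 3 → Matrix (Fin 3) (Fin 3) ℂ) : Prop :=
  ∀ (c : ℂ) (r : ℝ), Metric.ball c r ⊆ U →
    ∀ t ∈ Metric.ball c r, ∀ t' ∈ Metric.ball c r, ∀ z₀ : ℂ,
      ∃ C : GL (Fin 3) ℂ, ∀ γ : Path z₀ z₀,
        (∀ s, γ s ∉ Metric.ball c r ∧ γ s ≠ 0 ∧ γ s ≠ 1) →
        ∃ M : Matrix (Fin 3) (Fin 3) ℂ,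
          IsMonodromy (logMatrix (B t) t) γ M ∧
          IsMonodromy (logMatrix (B t') t') γ
            ((C : Matrix (Fin 3) (Fin 3) ℂ) * M * ((C⁻¹ : GL (Fin 3) ℂ) : Matrix _ _ ℂ))

/-- `θ₁ = λ₁ - μ₁`, `θ₂ = λ₂ - μ₁`, `θ₃ = λ₃ - μ₁`, `θ₄ = μ₃ - μ₂` (indices shifted by one). -/
def pviParam (lam mu : Fin 3 → ℂ) : Fin 4 → ℂ :=
  ![lam 0 - mu 0, lam 1 - mu 0, lam 2 - mu 0, mu 2 - mu 1]

/-- The function `x(t)` attached to `y(t)`. -/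
def xOf (θ : Fin 4 → ℂ) (y : ℂ → ℂ) (t : ℂ) : ℂ :=
  1 / 2 * (((t - 1) * deriv y t - θ 0) / y t + (deriv y t - 1 - θ 1) / (y t - t)
    - (t * deriv y t + θ 2) / (y t - 1))

/-- The residues `B₁, B₂, B₃` as functions of the numbers `x, y, t` and of `λ, μ`. -/
def residues (lam mu : Fin 3 → ℂ) (x y t : ℂ) : Fin 3 → Matrix (Fin 3) (Fin 3) ℂ :=
  let b₁₂ := lam 0 - mu 2 * y + (mu 0 - x * y) * (y - 1)
  let b₁₃ := lam 0 * t - mu 2 * y + (mu 0 - x * y) * (y - t)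
  let b₂₁ := lam 1 + (mu 2 * (y - t) - mu 0 * (y - 1) + x * (y - t) * (y - 1)) / (t - 1)
  let b₃₂ := (mu 1 - lam 1 - b₁₂) / t
  let b₂₃ := (mu 1 - lam 2) * t - b₁₃
  let b₃₁ := (mu 1 - lam 0 - b₂₁) / t
  ![!![lam 0, b₁₂, b₁₃; 0, 0, 0; 0, 0, 0],
    !![0, 0, 0; b₂₁, lam 1, b₂₃; 0, 0, 0],
    !![0, 0, 0; 0, 0, 0; b₃₁, b₃₂, lam 2]]

/-- The family of residues attached to a function `y(t)`. -/
def residueFamily (lam mu : Fin 3 → ℂ) (y : ℂ → ℂ) (t : ℂ) :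
    Fin 3 → Matrix (Fin 3) (Fin 3) ℂ :=
  residues lam mu (xOf (pviParam lam mu) y t) (y t) t

end

/-! With `x` as second coordinate, Painlevé VI becomes a Hamiltonian system, and along it the
residues satisfy the Schlesinger equations up to simultaneous conjugation, encoded by a matrix
`K(t)` (`hasDerivAt_residueFamily`; rational identities). This says that the connection with
`z`-component `A = logForm` and `t`-component `Ω = K - B₂/(z - t)` is flat.

For each fixed `z`, let `C(z, t)` be the parallel transport of `Ω` from `t₀` to `t`. Flatness gives
`∂C/∂z = A(t) C - C A(t₀)` (`hasDerivAt_transport`), so `C` carries solutions of `∇_{t₀}` to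
solutions of `∇_t`. Since `Ω` has its only finite pole in `z` at `z = t`, this transport is defined
on one `t`-disc for all `z` outside `V`, and it is single-valued in `z` although that region is not
simply connected. Composing such gauges joins any two parameters in `V`. Around a loop based at `z₀`
the gauge returns to its initial value, so `C(z₀)` conjugates all monodromies at once.

The pointwise claims on rank, trace and spectrum are algebra with the explicit rows. -/

/-! ### Hamiltonian form of Painlevé VI -/

/-- The right-hand side of the Hamiltonian form `y' = ∂H/∂x` of the sixth Painlevé equation. -/
noncomputable def hamiltonY (lam mu : Fin 3 → ℂ) (x y t : ℂ) : ℂ :=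
  (2 * x * y * (y - 1) * (y - t) + (lam 0 - mu 0) * (y - 1) * (y - t)
    + (1 + (lam 1 - mu 0)) * y * (y - 1) + (lam 2 - mu 0) * y * (y - t)) / (t * (t - 1))

/-- The right-hand side of the Hamiltonian form `x' = -∂H/∂y` of the sixth Painlevé equation. -/
noncomputable def hamiltonX (lam mu : Fin 3 → ℂ) (x y t : ℂ) : ℂ :=
  -(x ^ 2 * (3 * y ^ 2 - 2 * (1 + t) * y + t)
    + x * ((lam 0 - mu 0) * (2 * y - 1 - t) + (1 + (lam 1 - mu 0)) * (2 * y - 1)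
      + (lam 2 - mu 0) * (2 * y - t))
    + (mu 2 - mu 0) * (mu 1 - mu 0 + 1)) / (t * (t - 1))

/-- The definition of `x` is affine in `y'`, with leading coefficient `t(t-1) / (2y(y-1)(y-t))`;
this is that definition solved for `y'`. -/
theorem deriv_eq_hamiltonY (lam mu : Fin 3 → ℂ) (y : ℂ → ℂ) {t : ℂ} (ht0 : t ≠ 0) (ht1 : t ≠ 1)
    (hy0 : y t ≠ 0) (hy1 : y t ≠ 1) (hyt : y t ≠ t) :
    deriv y t = hamiltonY lam mu (xOf (pviParam lam mu) y t) (y t) t := by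
  have h1 := sub_ne_zero.2 ht1
  have h2 := sub_ne_zero.2 hy1
  have h3 := sub_ne_zero.2 hyt
  simp only [hamiltonY, xOf, pviParam]
  generalize deriv y t = q
  generalize y t = v at *
  simp
  field_simp
  ring

theorem hasDerivAt_xOf (lam mu : Fin 3 → ℂ) (hsum : ∑ i, lam i = ∑ i, mu i)
    {U : Set ℂ} (hU : IsOpen U) (h0 : (0 : ℂ) ∉ U) (h1 : (1 : ℂ) ∉ U)
    {y : ℂ → ℂ} (hy : SolvesPVI (pviParam lam mu) U y) {t : ℂ} (ht : t ∈ U) :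
    HasDerivAt (xOf (pviParam lam mu) y)
      (hamiltonX lam mu (xOf (pviParam lam mu) y t) (y t) t) t := by
  obtain ⟨hdiff, hy⟩ := hy
  obtain ⟨hy0, hy1, hyt, hpvi⟩ := hy t ht
  have ht0 : t ≠ 0 := fun h => h0 (h ▸ ht)
  have ht1 : t ≠ 1 := fun h => h1 (h ▸ ht)
  have k1 := sub_ne_zero.2 ht1
  have k2 := sub_ne_zero.2 hy1
  have k3 := sub_ne_zero.2 hyt
  have dy : HasDerivAt y (deriv y t) t := (hdiff.differentiableAt (hU.mem_nhds ht)).hasDerivAt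
  have ddy : HasDerivAt (deriv y) (deriv (deriv y) t) t :=
    ((hdiff.deriv hU).differentiableAt (hU.mem_nhds ht)).hasDerivAt
  have did := hasDerivAt_id' t
  have main := ((((((did.sub_const 1).mul ddy).sub_const (pviParam lam mu 0)).div dy hy0).add
    (((ddy.sub_const 1).sub_const (pviParam lam mu 1)).div (dy.sub did) k3)).sub
    (((did.mul ddy).add_const (pviParam lam mu 2)).div (dy.sub_const 1) k2)).const_mul (1 / 2)
  refine HasDerivAt.congr_deriv (f := xOf (pviParam lam mu) y) main ?_
  rw [hpvi]
  simp only [Fin.sum_univ_three] at hsum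
  -- By the trace relation, the constant `(μ₃-μ₁)(μ₂-μ₁+1)` in `hamiltonX` is `((θ₁+θ₂+θ₃+1)² -
  -- (θ₄-1)²)/4`, which is how `α` enters.
  have hl : lam 2 = mu 0 + mu 1 + mu 2 - lam 0 - lam 1 := by linear_combination hsum
  simp only [hamiltonX, xOf, pviParam, Pi.mul_apply, Pi.sub_apply]
  generalize deriv y t = q
  generalize y t = v at *
  simp [hl]
  field_simp
  ring

/-! ### Schlesinger equations for the residues -/

/-- The `z`-independent part of the `t`-component of the isomonodromic deformation. -/
noncomputable def gaugeMatrix (B : Fin 3 → Matrix (Fin 3) (Fin 3) ℂ) (t : ℂ) :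
    Matrix (Fin 3) (Fin 3) ℂ :=
  -- The off-diagonal entries cancel the part of the Schlesinger brackets outside row `i` of `Bᵢ`.
  -- The diagonal ones then give `(1,1,t) K = -(0,0,1)`, so that the normalisation of the residues,
  -- a left eigenvector `(1,1,t)` of `∑ Bᵢ` with eigenvalue `μ₂`, is preserved.
  !![B 1 1 0 / t, -B 0 0 1 / t, 0;
    -B 1 1 0 / t, B 0 0 1 / t + t * B 2 2 1 / (t - 1), -B 1 1 2 / (t - 1);
    0, -B 2 2 1 / (t - 1), (B 1 1 2 / (t - 1) - 1) / t]

/-- The right-hand side of the Schlesinger equations for poles `0, t, 1`, in the gauge `K`. -/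
noncomputable def schlesingerField {R : Type*} [Ring R] [Module ℂ R]
    (B : Fin 3 → R) (K : R) (t : ℂ) : Fin 3 → R :=
  ![t⁻¹ • (B 1 * B 0 - B 0 * B 1) + (K * B 0 - B 0 * K),
    t⁻¹ • (B 0 * B 1 - B 1 * B 0) + (t - 1)⁻¹ • (B 2 * B 1 - B 1 * B 2) + (K * B 1 - B 1 * K),
    (t - 1)⁻¹ • (B 1 * B 2 - B 2 * B 1) + (K * B 2 - B 2 * K)]

/-- The matrix whose rows are the nonzero rows of the three residues. -/
noncomputable def residueSum (lam mu : Fin 3 → ℂ) (x y t : ℂ) : Matrix (Fin 3) (Fin 3) ℂ :=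
  let b₁₂ := lam 0 - mu 2 * y + (mu 0 - x * y) * (y - 1)
  let b₁₃ := lam 0 * t - mu 2 * y + (mu 0 - x * y) * (y - t)
  let b₂₁ := lam 1 + (mu 2 * (y - t) - mu 0 * (y - 1) + x * (y - t) * (y - 1)) / (t - 1)
  let b₃₂ := (mu 1 - lam 1 - b₁₂) / t
  let b₂₃ := (mu 1 - lam 2) * t - b₁₃
  let b₃₁ := (mu 1 - lam 0 - b₂₁) / t
  !![lam 0, b₁₂, b₁₃; b₂₁, lam 1, b₂₃; b₃₁, b₃₂, lam 2]

/-- The three matrices obtained from `b` by keeping one row and annihilating the others. -/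
def rowParts (b : Matrix (Fin 3) (Fin 3) ℂ) (i : Fin 3) : Matrix (Fin 3) (Fin 3) ℂ :=
  Matrix.of fun j k => if j = i then b j k else 0

theorem residues_eq_rowParts (lam mu : Fin 3 → ℂ) (x y t : ℂ) :
    residues lam mu x y t = rowParts (residueSum lam mu x y t) := by
  ext i j k
  fin_cases i <;> fin_cases j <;> fin_cases k <;> simp [residues, residueSum, rowParts]

/-- The Schlesinger vector field on residues that are the rows of a matrix `b`, in the gauge
preserving this shape. -/
noncomputable def rowField (b : Matrix (Fin 3) (Fin 3) ℂ) (t : ℂ) : Matrix (Fin 3) (Fin 3) ℂ :=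
  let K := gaugeMatrix (rowParts b) t
  !![0,
      -b 0 1 * b 1 1 / t + K 0 0 * b 0 1 - b 0 0 * K 0 1 - b 0 1 * K 1 1 - b 0 2 * K 2 1,
      -b 0 1 * b 1 2 / t + K 0 0 * b 0 2 - b 0 1 * K 1 2 - b 0 2 * K 2 2;
    -b 1 0 * b 0 0 / t - b 1 2 * b 2 0 / (t - 1) + K 1 1 * b 1 0 - b 1 0 * K 0 0 - b 1 1 * K 1 0,
      0,
      -b 1 0 * b 0 2 / t - b 1 2 * b 2 2 / (t - 1) + K 1 1 * b 1 2 - b 1 1 * K 1 2 - b 1 2 * K 2 2;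
    -b 2 1 * b 1 0 / (t - 1) + K 2 2 * b 2 0 - b 2 0 * K 0 0 - b 2 1 * K 1 0,
      -b 2 1 * b 1 1 / (t - 1) + K 2 2 * b 2 1 - b 2 0 * K 0 1 - b 2 1 * K 1 1 - b 2 2 * K 2 1,
      0]

/-- The off-diagonal part of `K` keeps each residue in its row. The diagonal of `rowField` is zero
because commutators have trace zero, whence the traces `λᵢ` are constant. -/
theorem schlesingerField_rowParts (b : Matrix (Fin 3) (Fin 3) ℂ) (t : ℂ) :
    schlesingerField (rowParts b) (gaugeMatrix (rowParts b) t) t = rowParts (rowField b t) := by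
  ext i j k
  fin_cases i <;> fin_cases j <;> fin_cases k <;>
    simp [schlesingerField, rowParts, rowField, gaugeMatrix, Matrix.mul_apply,
      Fin.sum_univ_three, Matrix.vecHead, Matrix.vecTail] <;> ring

/-- In Hamiltonian form only `t` and `t - 1` occur as denominators, so each entry reduces to a
polynomial identity in `x`, `y`, `t` and the parameters. -/
theorem hasDerivAt_residueSum (lam mu : Fin 3 → ℂ) (hsum : ∑ i, lam i = ∑ i, mu i)
    {x y : ℂ → ℂ} {t : ℂ} (ht0 : t ≠ 0) (ht1 : t ≠ 1)
    (dx : HasDerivAt x (hamiltonX lam mu (x t) (y t) t) t)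
    (dy : HasDerivAt y (hamiltonY lam mu (x t) (y t) t) t) (j k : Fin 3) :
    HasDerivAt (fun s => residueSum lam mu (x s) (y s) s j k)
      (rowField (residueSum lam mu (x t) (y t) t) t j k) t := by
  have k1 := sub_ne_zero.2 ht1
  have did := hasDerivAt_id' t
  simp only [Fin.sum_univ_three] at hsum
  have hl : lam 2 = mu 0 + mu 1 + mu 2 - lam 0 - lam 1 := by linear_combination hsum
  have d12 := (((dy.const_mul (mu 2)).const_sub (lam 0))).add
    (((dx.mul dy).const_sub (mu 0)).mul (dy.sub_const 1))
  have d13 := ((did.const_mul (lam 0)).sub (dy.const_mul (mu 2))).add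
    (((dx.mul dy).const_sub (mu 0)).mul (dy.sub did))
  have d21 := ((((((dy.sub did).const_mul (mu 2)).sub ((dy.sub_const 1).const_mul (mu 0))).add
    ((dx.mul (dy.sub did)).mul (dy.sub_const 1))).div (did.sub_const 1) k1)).const_add (lam 1)
  have d32 := (d12.const_sub (mu 1 - lam 1)).div did ht0
  have d23 := (did.const_mul (mu 1 - lam 2)).sub d13
  have d31 := (d21.const_sub (mu 1 - lam 0)).div did ht0
  fin_cases j <;> fin_cases k
  · exact hasDerivAt_const t _
  · refine d12.congr_deriv ?_
    simp [rowField, gaugeMatrix, rowParts, residueSum, hamiltonX, hamiltonY, hl]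
    field_simp
    ring
  · refine d13.congr_deriv ?_
    simp [rowField, gaugeMatrix, rowParts, residueSum, hamiltonX, hamiltonY, hl]
    field_simp
    ring
  · refine d21.congr_deriv ?_
    simp [rowField, gaugeMatrix, rowParts, residueSum, hamiltonX, hamiltonY, hl]
    field_simp
    ring
  · exact hasDerivAt_const t _
  · refine d23.congr_deriv ?_
    simp [rowField, gaugeMatrix, rowParts, residueSum, hamiltonX, hamiltonY, hl]
    field_simp
    ring
  · refine d31.congr_deriv ?_
    simp [rowField, gaugeMatrix, rowParts, residueSum, hamiltonX, hamiltonY, hl]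
    field_simp
    ring
  · refine d32.congr_deriv ?_
    simp [rowField, gaugeMatrix, rowParts, residueSum, hamiltonX, hamiltonY, hl]
    field_simp
    ring
  · exact hasDerivAt_const t _

theorem hasDerivAt_residueFamily (lam mu : Fin 3 → ℂ) (hsum : ∑ i, lam i = ∑ i, mu i)
    {U : Set ℂ} (hU : IsOpen U) (h0 : (0 : ℂ) ∉ U) (h1 : (1 : ℂ) ∉ U)
    {y : ℂ → ℂ} (hy : SolvesPVI (pviParam lam mu) U y) {t : ℂ} (ht : t ∈ U) (i j k : Fin 3) :
    HasDerivAt (fun s => residueFamily lam mu y s i j k)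
      (schlesingerField (residueFamily lam mu y t) (gaugeMatrix (residueFamily lam mu y t) t)
        t i j k) t := by
  have dx := hasDerivAt_xOf lam mu hsum hU h0 h1 hy ht
  have dy : HasDerivAt y (deriv y t) t := (hy.1.differentiableAt (hU.mem_nhds ht)).hasDerivAt
  obtain ⟨hy0, hy1, hyt, -⟩ := hy.2 t ht
  have ht0 : t ≠ 0 := fun h => h0 (h ▸ ht)
  have ht1 : t ≠ 1 := fun h => h1 (h ▸ ht)
  rw [deriv_eq_hamiltonY lam mu y ht0 ht1 hy0 hy1 hyt] at dy
  have main := hasDerivAt_residueSum lam mu hsum ht0 ht1 dx dy j k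
  simp only [residueFamily, residues_eq_rowParts, schlesingerField_rowParts]
  by_cases h : j = i
  · simpa [rowParts, h] using main
  · simpa [rowParts, h] using hasDerivAt_const t (0 : ℂ)

/-! ### Rank, trace and spectrum of the residues -/

theorem rank_rowParts_le_one (b : Matrix (Fin 3) (Fin 3) ℂ) (i : Fin 3) :
    (rowParts b i).rank ≤ 1 := by
  have : rowParts b i = Matrix.vecMulVec (Pi.single i 1) (b i) := by
    ext j k
    by_cases h : j = i
    · subst h; simp [rowParts, Matrix.vecMulVec_apply]
    · simp [rowParts, Matrix.vecMulVec_apply, h]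
  rw [this]
  exact Matrix.rank_vecMulVec_le _ _

theorem rank_rowParts_eq_one {b : Matrix (Fin 3) (Fin 3) ℂ} {i k : Fin 3} (h : b i k ≠ 0) :
    (rowParts b i).rank = 1 := by
  refine le_antisymm (rank_rowParts_le_one b i) (Nat.one_le_iff_ne_zero.2 fun h0 => h ?_)
  have hz : (rowParts b i).mulVecLin = 0 :=
    LinearMap.range_eq_bot.1 (Submodule.finrank_eq_zero.1 h0)
  have := congrFun (LinearMap.congr_fun hz (Pi.single k 1)) i
  simpa [rowParts] using this

theorem trace_rowParts (b : Matrix (Fin 3) (Fin 3) ℂ) (i : Fin 3) :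
    (rowParts b i).trace = b i i := by
  simp [rowParts, Matrix.trace]

theorem sum_rowParts (b : Matrix (Fin 3) (Fin 3) ℂ) : ∑ i, rowParts b i = b := by
  ext j k
  simp [rowParts, Matrix.sum_apply]

theorem charpoly_residueSum (lam mu : Fin 3 → ℂ) (hsum : ∑ i, lam i = ∑ i, mu i)
    {x y t : ℂ} (ht0 : t ≠ 0) (ht1 : t ≠ 1) :
    (residueSum lam mu x y t).charpoly = ∏ i, (Polynomial.X - Polynomial.C (mu i)) := by
  have k1 := sub_ne_zero.2 ht1
  simp only [Fin.sum_univ_three] at hsum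
  have hl : lam 2 = mu 0 + mu 1 + mu 2 - lam 0 - lam 1 := by linear_combination hsum
  refine Polynomial.funext fun z => ?_
  rw [Matrix.eval_charpoly, Matrix.det_fin_three, Fin.prod_univ_three]
  simp [residueSum, hl]
  field_simp
  ring

/-- If row `i` vanishes, so does its diagonal entry `λᵢ`; eliminating `x` from the other two entries
leaves `μ₃y = 0`, `μ₃(y-t) = 0` or `μ₃(y-1) = 0` respectively. This is where `y ∉ {0, t, 1}` enters.
-/
theorem exists_residueSum_ne_zero (lam mu : Fin 3 → ℂ) (hsum : ∑ i, lam i = ∑ i, mu i)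
    {x y t : ℂ} (ht0 : t ≠ 0) (ht1 : t ≠ 1) (hy0 : y ≠ 0) (hy1 : y ≠ 1) (hyt : y ≠ t)
    {i : Fin 3} (h : lam i ≠ 0 ∨ mu 2 ≠ 0) : ∃ k, residueSum lam mu x y t i k ≠ 0 := by
  have k1 := sub_ne_zero.2 ht1
  have k2 := sub_ne_zero.2 hy1
  have k3 := sub_ne_zero.2 hyt
  simp only [Fin.sum_univ_three] at hsum
  have hl : lam 2 = mu 0 + mu 1 + mu 2 - lam 0 - lam 1 := by linear_combination hsum
  by_contra! hz
  have hm : lam i = 0 → mu 2 = 0 := by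
    intro hi
    have e0 := hz 0
    have e1 := hz 1
    have e2 := hz 2
    fin_cases i
    · simp [residueSum] at e0 e1 e2 hi
      rw [hi] at e1 e2
      have : (mu 0 - x * y) * (t - 1) = 0 := by linear_combination e1 - e2
      have hx := (mul_eq_zero.1 this).resolve_right k1
      exact (mul_eq_zero.1 (show mu 2 * y = 0 by
        linear_combination (y - 1) * hx - e1)).resolve_right hy0
    · simp [residueSum, hl] at e0 e1 e2 hi
      rw [hi] at e0 e2
      field_simp at e0
      have hx : x * (y - t) - mu 0 = 0 := by linear_combination e2 - e0
      exact (mul_eq_zero.1 (show mu 2 * (y - t) = 0 by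
        linear_combination e0 - (y - 1) * hx)).resolve_right k3
    · simp [residueSum, ht0] at e0 e1 e2 hi
      rw [hl] at hi
      field_simp at e0
      have : (mu 0 - x * (y - 1)) * t = 0 := by linear_combination t * hi - e0 - e1
      have hx := (mul_eq_zero.1 this).resolve_right ht0
      exact (mul_eq_zero.1 (show mu 2 * (y - 1) = 0 by
        linear_combination e1 + y * hx - hi)).resolve_right k2
  have : lam i = 0 := by
    have := hz i
    fin_cases i <;> simpa [residueSum] using this
  exact h.elim (· this) (· (hm this))

/-! ### Linear differential equations in a Banach algebra -/

section LinearODE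

variable {R : Type*} [NormedRing R] [NormedAlgebra ℂ R]

/-- The Taylor coefficients of the solution `Φ` of `Φ' = f Φ`, `Φ(0) = 1`, where `a` are the Taylor
coefficients of `f`. -/
noncomputable def fundamentalCoeff (a : ℕ → R) : ℕ → R
  | 0 => 1
  | n + 1 => ((n : ℂ) + 1)⁻¹ • ∑ k : Fin (n + 1), a (n - k) * fundamentalCoeff a k

theorem succ_smul_fundamentalCoeff (a : ℕ → R) (n : ℕ) :
    ((n : ℂ) + 1) • fundamentalCoeff a (n + 1) =
      ∑ p ∈ Finset.HasAntidiagonal.antidiagonal n, a p.1 * fundamentalCoeff a p.2 := by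
  rw [fundamentalCoeff, smul_inv_smul₀ (Nat.cast_add_one_ne_zero n),
    ← Finset.Nat.sum_antidiagonal_swap, Finset.Nat.sum_antidiagonal_eq_sum_range_succ_mk,
    Finset.sum_range]
  rfl

/-- Majorant argument: `1/(1 - Mz)` solves `φ' = M/(1 - Mz) φ`. In the recursion, the `n + 1`
summands are each at most `M ^ (n + 1)` and the factor `1/(n + 1)` cancels their number. -/
theorem norm_fundamentalCoeff_le [NormOneClass R] {a : ℕ → R} {M : ℝ}
    (ha : ∀ n, ‖a n‖ ≤ M ^ (n + 1)) (n : ℕ) : ‖fundamentalCoeff a n‖ ≤ M ^ n := by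
  have hM : 0 ≤ M := by simpa using (norm_nonneg _).trans (ha 0)
  induction n using Nat.strong_induction_on with
  | _ n ih =>
    cases n with
    | zero => simp [fundamentalCoeff]
    | succ n =>
      rw [fundamentalCoeff, norm_smul, norm_inv]
      have h1 : ‖(n : ℂ) + 1‖ = n + 1 := by
        exact_mod_cast Complex.norm_natCast (n + 1)
      rw [h1, inv_mul_le_iff₀ (by positivity)]
      calc ‖∑ k : Fin (n + 1), a (n - k) * fundamentalCoeff a k‖
          ≤ ∑ k : Fin (n + 1), M ^ (n + 1) := by
            refine norm_sum_le_of_le _ fun k _ => (norm_mul_le _ _).trans ?_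
            have hk : (n - k + 1) + (k : ℕ) = n + 1 := by have := k.2; omega
            calc ‖a (n - k)‖ * ‖fundamentalCoeff a k‖ ≤ M ^ (n - k + 1) * M ^ (k : ℕ) :=
                  mul_le_mul (ha _) (ih _ k.2) (norm_nonneg _) (by positivity)
              _ = M ^ (n + 1) := by rw [← pow_add, hk]
        _ = (n + 1) * M ^ (n + 1) := by simp

theorem hasDerivAt_tsum_pow_smul [CompleteSpace R] {b : ℕ → R} {M : ℝ} (hM : 0 < M)
    (hb : ∀ n, ‖b n‖ ≤ M ^ n) {c z : ℂ} (hz : z ∈ Metric.ball c (1 / M)) :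
    HasDerivAt (fun w => ∑' n, (w - c) ^ n • b n)
      (∑' n : ℕ, (z - c) ^ n • (((n : ℂ) + 1) • b (n + 1))) z := by
  obtain ⟨ρ, hρ, hρM⟩ := exists_between (Metric.mem_ball.1 hz)
  have hρ0 : 0 < ρ := dist_nonneg.trans_lt hρ
  have hMρ : ‖M * ρ‖ < 1 := by
    rw [Real.norm_of_nonneg (by positivity), mul_comm]
    exact (lt_div_iff₀ hM).1 hρM
  have hu : Summable fun n : ℕ => (n : ℝ) * ρ ^ (n - 1) * M ^ n := by
    rw [← summable_nat_add_iff 1]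
    have h1 := (summable_pow_mul_geometric_of_norm_lt_one 1 hMρ).mul_left M
    have h2 := (summable_geometric_of_norm_lt_one hMρ).mul_left M
    refine (h1.add h2).congr fun n => ?_
    push_cast
    simp only [mul_pow]
    ring
  have hball : IsPreconnected (Metric.ball c ρ) := (convex_ball c ρ).isPreconnected
  have key := hasDerivAt_tsum_of_isPreconnected (𝕜 := ℂ)
    (g := fun n (w : ℂ) => (w - c) ^ n • b n)
    (g' := fun n (w : ℂ) => ((n : ℂ) * (w - c) ^ (n - 1)) • b n) hu Metric.isOpen_ball hball
    (fun n w _ => by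
      have := (((hasDerivAt_id' w).sub_const c).pow n).smul_const (b n)
      simpa using this)
    (fun n w hw => by
      rw [norm_smul, norm_mul, norm_pow, Complex.norm_natCast]
      have : ‖w - c‖ ≤ ρ := (mem_ball_iff_norm.1 hw).le
      gcongr
      exact hb n)
    (Metric.mem_ball_self hρ0)
    (summable_of_ne_finset_zero (s := {0}) fun n hn => by
      have : n ≠ 0 := by simpa using hn
      simp [this])
    (Metric.mem_ball.2 hρ)
  refine key.congr_deriv ?_
  have hs : Summable fun n : ℕ => ((n : ℂ) * (z - c) ^ (n - 1)) • b n := by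
    refine Summable.of_norm_bounded hu fun n => ?_
    rw [norm_smul, norm_mul, norm_pow, Complex.norm_natCast]
    have : ‖z - c‖ ≤ ρ := (mem_ball_iff_norm.1 (Metric.mem_ball.2 hρ)).le
    gcongr
    exact hb n
  rw [hs.tsum_eq_zero_add]
  simp [smul_smul, mul_comm]

theorem summable_norm_pow_smul {b : ℕ → R} {M N : ℝ} (hM : 0 < M)
    (hb : ∀ n, ‖b n‖ ≤ N * M ^ n) {w : ℂ} (hw : ‖w‖ < 1 / M) :
    Summable fun n => ‖w ^ n • b n‖ := by
  have h : ‖M * ‖w‖‖ < 1 := by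
    rw [Real.norm_of_nonneg (by positivity), mul_comm]
    exact (lt_div_iff₀ hM).1 hw
  refine Summable.of_nonneg_of_le (fun _ => norm_nonneg _) (fun n => ?_)
    ((summable_geometric_of_norm_lt_one h).mul_left N)
  rw [norm_smul, norm_pow, mul_pow]
  calc ‖w‖ ^ n * ‖b n‖ ≤ ‖w‖ ^ n * (N * M ^ n) := by gcongr; exact hb n
    _ = N * (M ^ n * ‖w‖ ^ n) := by ring

/-- A holomorphic linear differential equation `Φ' = f Φ` has a solution near `c` with `Φ c = 1`,
on a disc whose radius depends only on bounds for `f`. -/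
theorem exists_linearODE_solution [CompleteSpace R] [NormOneClass R] {f : ℂ → R} {c : ℂ}
    {r M : ℝ} (hr : 0 < r) (hM : 1 / r ≤ M) (hf : DifferentiableOn ℂ f (Metric.ball c (2 * r)))
    (hb : ∀ z ∈ Metric.ball c (2 * r), ‖f z‖ ≤ M) :
    ∃ Φ : ℂ → R, Φ c = 1 ∧
      (∀ z ∈ Metric.ball c (1 / M), HasDerivAt Φ (f z * Φ z) z) ∧
      ∀ z ∈ Metric.ball c (1 / (3 * M)), ‖Φ z - 1‖ < 1 := by
  have hM0 : 0 < M := lt_of_lt_of_le (by positivity) hM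
  have hrM : r⁻¹ ≤ M := by simpa using hM
  set a : ℕ → R := fun n => ((n.factorial : ℂ)⁻¹) • iteratedDeriv n f c with ha
  have han : ∀ n, ‖a n‖ ≤ M ^ (n + 1) := by
    intro n
    -- Cauchy's estimate on the circle of radius `r` gives `‖a n‖ ≤ M r⁻ⁿ`, and `r⁻¹ ≤ M`.
    have h := Complex.norm_iteratedDeriv_le_of_forall_mem_sphere_norm_le (f := f) (c := c) n hr
      ((hf.mono (Metric.closedBall_subset_ball (by linarith))).diffContOnCl_ball subset_rfl)
      (C := M) (fun z hz => hb z (Metric.sphere_subset_closedBall.trans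
        (Metric.closedBall_subset_ball (by linarith)) hz))
    have hn : 0 < (n.factorial : ℝ) := by positivity
    rw [ha]
    simp only [norm_smul, norm_inv, Complex.norm_natCast]
    rw [inv_mul_le_iff₀ hn]
    refine h.trans ?_
    rw [div_eq_mul_inv, mul_assoc, ← inv_pow, pow_succ']
    gcongr
  set b := fundamentalCoeff a with hbdef
  have hbn : ∀ n, ‖b n‖ ≤ M ^ n := norm_fundamentalCoeff_le han
  have hr1 : 1 / M ≤ r := by
    rw [div_le_iff₀ hM0, mul_comm]; exact (div_le_iff₀ hr).1 hM
  refine ⟨fun w => ∑' n, (w - c) ^ n • b n, ?_, fun z hz => ?_, fun z hz => ?_⟩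
  · simp only [sub_self]
    rw [tsum_eq_single 0 (fun n hn => by simp [hn])]
    simp [hbdef, fundamentalCoeff]
  · refine (hasDerivAt_tsum_pow_smul hM0 hbn hz).congr_deriv ?_
    have hw : ‖z - c‖ < 1 / M := mem_ball_iff_norm.1 hz
    have hz2 : z ∈ Metric.ball c (2 * r) := Metric.ball_subset_ball (by linarith) hz
    have hfz : f z = ∑' n, (z - c) ^ n • a n := by
      rw [← (Complex.hasSum_taylorSeries_on_ball hf hz2).tsum_eq]
      exact tsum_congr fun n => smul_comm _ _ _
    rw [hfz, tsum_mul_tsum_eq_tsum_sum_antidiagonal_of_summable_norm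
      (summable_norm_pow_smul (N := M) hM0 (fun n => (han n).trans_eq (pow_succ' _ _)) hw)
      (summable_norm_pow_smul (N := 1) hM0 (fun n => by simpa using hbn n) hw)]
    refine tsum_congr fun n => ?_
    rw [hbdef, succ_smul_fundamentalCoeff, Finset.smul_sum]
    refine Finset.sum_congr rfl fun p hp => ?_
    rw [smul_mul_smul_comm, ← pow_add, Finset.HasAntidiagonal.mem_antidiagonal.1 hp]
  · have hw : ‖z - c‖ < 1 / (3 * M) := mem_ball_iff_norm.1 hz
    have hw1 : ‖z - c‖ < 1 / M := hw.trans_le (by gcongr; linarith)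
    have hs := summable_norm_pow_smul (N := 1) hM0 (fun n => by simpa using hbn n) hw1
    have hq : M * ‖z - c‖ < 1 / 3 := by
      rw [lt_div_iff₀ (by positivity)] at hw
      linarith
    have hq0 : 0 ≤ M * ‖z - c‖ := by positivity
    -- With `q = M‖z - c‖ < 1/3`, the terms of positive degree sum to at most `q/(1 - q) < 1`; this
    -- will make `Φ z` invertible.
    have hgeo := (hasSum_geometric_of_lt_one hq0 (by linarith)).mul_left (M * ‖z - c‖)
    simp only
    rw [hs.of_norm.tsum_eq_zero_add]
    have h0 : (z - c) ^ 0 • b 0 = 1 := by simp [hbdef, fundamentalCoeff]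
    rw [h0, add_sub_cancel_left]
    refine (tsum_of_norm_bounded hgeo fun n => ?_).trans_lt ?_
    · rw [norm_smul, norm_pow, ← pow_succ', mul_pow, mul_comm]
      gcongr
      exact hbn _
    · rw [← div_eq_mul_inv, div_lt_one (by linarith)]
      linarith

variable {E : Type*} [NormedAddCommGroup E] [NormedSpace ℂ E]

/-- Grönwall's inequality for a function of a complex variable on a convex set. -/
theorem norm_le_of_hasDerivAt_of_convex {S : Set ℂ} (hS : Convex ℝ S) {u u' : ℂ → E}
    {c : ℂ} (hc : c ∈ S) {K ε r : ℝ} (hK : 0 < K) (hr : 0 < r)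
    (hu : ∀ z ∈ S, HasDerivAt u (u' z) z) (h0 : u c = 0)
    (hb : ∀ z ∈ S, ‖u' z‖ ≤ K * ‖u z‖ + ε) {z : ℂ} (hz : z ∈ S) (hzr : ‖z - c‖ ≤ r) :
    ‖u z‖ ≤ ε * ((Real.exp (K * r) - 1) / K) := by
  have hmem : ∀ s ∈ Set.Icc (0 : ℝ) 1, c + (s : ℂ) * (z - c) ∈ S := by
    intro s hs
    have := hS hc hz (sub_nonneg.2 hs.2) hs.1 (by ring)
    convert this using 1
    simp only [Complex.real_smul]
    push_cast
    ring
  have hd : ∀ s ∈ Set.Icc (0 : ℝ) 1, HasDerivAt (fun s : ℝ => u (c + (s : ℂ) * (z - c)))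
      ((z - c) • u' (c + (s : ℂ) * (z - c))) s := by
    intro s hs
    have h1 : HasDerivAt (fun s : ℝ => c + (s : ℂ) * (z - c)) (z - c) s := by
      simpa using ((Complex.ofRealCLM.hasDerivAt (x := s)).mul_const (z - c)).const_add c
    exact (hu _ (hmem s hs)).scomp s h1
  have := norm_le_gronwallBound_of_norm_deriv_right_le (a := 0) (b := 1) (δ := 0) (K := K * r)
    (ε := ε * r) (f := fun s : ℝ => u (c + (s : ℂ) * (z - c)))
    (fun s hs => (hd s hs).continuousAt.continuousWithinAt)
    (fun s hs => (hd s (Set.Ico_subset_Icc_self hs)).hasDerivWithinAt)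
    (by simp [h0])
    (fun s hs => by
      rw [norm_smul]
      have h := hb _ (hmem s (Set.Ico_subset_Icc_self hs))
      calc ‖z - c‖ * ‖u' (c + (s : ℂ) * (z - c))‖
          ≤ r * (K * ‖u (c + (s : ℂ) * (z - c))‖ + ε) := by gcongr
        _ = _ := by ring) 1 (by simp)
  rw [gronwallBound_of_K_ne_0 (by positivity)] at this
  simp only [Complex.ofReal_one, one_mul, add_sub_cancel, zero_mul, zero_add, sub_zero,
    mul_one] at this
  refine this.trans_eq ?_
  field_simp

/-- Two solutions of a linear differential equation on a convex set that agree at one point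
coincide. -/
theorem eqOn_of_linearODE {S : Set ℂ} (hS : Convex ℝ S) {f u v : ℂ → R} {c : ℂ} (hc : c ∈ S)
    {K : ℝ} (hf : ∀ z ∈ S, ‖f z‖ ≤ K)
    (hu : ∀ z ∈ S, HasDerivAt u (f z * u z) z) (hv : ∀ z ∈ S, HasDerivAt v (f z * v z) z)
    (h : u c = v c) : Set.EqOn u v S := by
  intro z hz
  have hK : 0 ≤ K := (norm_nonneg _).trans (hf c hc)
  -- `K` may be zero, while the Grönwall bound divides by its constant. With `ε = 0` that bound is
  -- zero.
  have := norm_le_of_hasDerivAt_of_convex hS hc (K := K + 1) (r := ‖z - c‖ + 1) (ε := 0)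
    (u := fun z => u z - v z) (u' := fun z => f z * u z - f z * v z) (by linarith)
    (by positivity) (fun z hz => (hu z hz).sub (hv z hz)) (by simp [h])
    (fun w hw => by
      rw [← mul_sub, add_zero]
      refine (norm_mul_le _ _).trans ?_
      gcongr
      linarith [hf w hw]) hz (by linarith)
  rw [zero_mul] at this
  exact sub_eq_zero.1 (norm_le_zero_iff.1 this)

end LinearODE

/-! ### Analytic continuation along paths -/

section Continuation

variable {R : Type*} [NormedRing R] [NormedAlgebra ℂ R]

/-- `Y` is the analytic continuation along `γ`, on the interval `[a, b]`, of a solution of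
`Φ' = f Φ`. -/
def IsContinuationOn (f : ℂ → R) (γ : ℝ → ℂ) (a b : ℝ) (Y : ℝ → R) : Prop :=
  ∀ s ∈ Set.Icc a b, ∃ Φ : ℂ → R, (∀ᶠ z in 𝓝 (γ s), HasDerivAt Φ (f z * Φ z) z) ∧
    ∀ᶠ s' in 𝓝[Set.Icc a b] s, Y s' = Φ (γ s')

theorem IsContinuationOn.glue {f : ℂ → R} {γ : ℝ → ℂ} {a b c : ℝ} {Y₁ Y₂ : ℝ → R}
    (h₁ : IsContinuationOn f γ a b Y₁) (h₂ : IsContinuationOn f γ b c Y₂) (hab : a ≤ b)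
    (hbc : b ≤ c) (hY : Y₁ b = Y₂ b) (hγ : Continuous γ) (hf : ContinuousAt f (γ b)) :
    IsContinuationOn f γ a c (fun s => if s ≤ b then Y₁ s else Y₂ s) := by
  intro s hs
  rcases lt_trichotomy s b with hsb | rfl | hsb
  · obtain ⟨Φ, hΦ, hΦY⟩ := h₁ s ⟨hs.1, hsb.le⟩
    refine ⟨Φ, hΦ, ?_⟩
    rw [eventually_nhdsWithin_iff] at hΦY ⊢
    filter_upwards [hΦY, Iio_mem_nhds hsb] with s' h1 h2 h3
    rw [if_pos (le_of_lt h2)]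
    exact h1 ⟨h3.1, le_of_lt h2⟩
  · obtain ⟨Φ₁, hΦ₁, hΦY₁⟩ := h₁ s ⟨hab, le_rfl⟩
    obtain ⟨Φ₂, hΦ₂, hΦY₂⟩ := h₂ s ⟨le_rfl, hbc⟩
    have e₁ := hΦY₁.self_of_nhdsWithin ⟨hab, le_rfl⟩
    have e₂ := hΦY₂.self_of_nhdsWithin ⟨le_rfl, hbc⟩
    have hbd : ∀ᶠ z in 𝓝 (γ s), ‖f z‖ ≤ ‖f (γ s)‖ + 1 :=
      (hf.norm.eventually_lt continuousAt_const (lt_add_one _)).mono fun _ h => le_of_lt h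
    obtain ⟨ε, hε, hball⟩ := Metric.eventually_nhds_iff_ball.1 (hΦ₁.and (hΦ₂.and hbd))
    -- At the junction the two local solutions have the same value, so uniqueness identifies them on
    -- a disc.
    have heq : Set.EqOn Φ₁ Φ₂ (Metric.ball (γ s) ε) :=
      eqOn_of_linearODE (convex_ball _ _) (Metric.mem_ball_self hε) (fun z hz => (hball z hz).2.2)
        (fun z hz => (hball z hz).1) (fun z hz => (hball z hz).2.1) (by rw [← e₁, ← e₂, hY])
    refine ⟨Φ₁, hΦ₁, ?_⟩
    rw [eventually_nhdsWithin_iff] at hΦY₁ hΦY₂ ⊢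
    filter_upwards [hΦY₁, hΦY₂, hγ.continuousAt.eventually (Metric.ball_mem_nhds _ hε)]
      with s' h1 h2 h3 h4
    split_ifs with h
    · exact h1 ⟨h4.1, h⟩
    · exact (h2 ⟨(not_le.1 h).le, h4.2⟩).trans (heq h3).symm
  · obtain ⟨Φ, hΦ, hΦY⟩ := h₂ s ⟨hsb.le, hs.2⟩
    refine ⟨Φ, hΦ, ?_⟩
    rw [eventually_nhdsWithin_iff] at hΦY ⊢
    filter_upwards [hΦY, Ioi_mem_nhds hsb] with s' h1 h2 h3
    rw [if_neg (not_le.2 h2)]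
    exact h1 ⟨le_of_lt h2, h3.2⟩

/-- Solutions of a holomorphic linear differential equation can be continued along every path. -/
theorem exists_isContinuationOn [CompleteSpace R] [NormOneClass R] {f : ℂ → R} {W : Set ℂ}
    (hW : IsOpen W) (hf : DifferentiableOn ℂ f W) {γ : ℝ → ℂ} (hγ : Continuous γ)
    (hγW : ∀ s ∈ Set.Icc (0 : ℝ) 1, γ s ∈ W) :
    ∃ Y : ℝ → R, Y 0 = 1 ∧ IsContinuationOn f γ 0 1 Y := by
  have hK : IsCompact (γ '' Set.Icc 0 1) := isCompact_Icc.image hγ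
  obtain ⟨δ, hδ, hδW⟩ := hK.exists_cthickening_subset_open hW (Set.image_subset_iff.2 hγW)
  obtain ⟨M₀, hM₀⟩ := (hK.cthickening (r := δ)).exists_bound_of_continuousOn
    (hf.continuousOn.mono hδW)
  -- A bound on a compact thickening of the path yields local solutions on discs of one radius `1 /
  -- M`; uniform continuity then cuts the path into `N + 1` pieces, each inside such a disc.
  set M := max M₀ (1 / (δ / 2)) with hM
  have hM0 : 0 < M := lt_max_of_lt_right (by positivity)
  have hsub : ∀ s ∈ Set.Icc (0 : ℝ) 1,
      Metric.ball (γ s) (2 * (δ / 2)) ⊆ Metric.cthickening δ (γ '' Set.Icc 0 1) := by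
    intro s hs
    rw [mul_div_cancel₀ _ two_ne_zero]
    exact Metric.ball_subset_closedBall.trans
      (Metric.closedBall_subset_cthickening (Set.mem_image_of_mem γ hs) δ)
  have hloc : ∀ s ∈ Set.Icc (0 : ℝ) 1, ∃ Φ : ℂ → R, Φ (γ s) = 1 ∧
      ∀ z ∈ Metric.ball (γ s) (1 / M), HasDerivAt Φ (f z * Φ z) z := by
    intro s hs
    obtain ⟨Φ, h1, h2, -⟩ := exists_linearODE_solution (f := f) (c := γ s) (r := δ / 2) (M := M)
      (by positivity) (le_max_right _ _) (hf.mono ((hsub s hs).trans hδW))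
      (fun z hz => (hM₀ z (hsub s hs hz)).trans (le_max_left _ _))
    exact ⟨Φ, h1, h2⟩
  obtain ⟨η, hη, hηγ⟩ := Metric.uniformContinuousOn_iff.1
    (isCompact_Icc.uniformContinuousOn_of_continuous (hγ.continuousOn (s := Set.Icc 0 1)))
    (1 / M) (by positivity)
  obtain ⟨N, hN⟩ := exists_nat_one_div_lt hη
  have hN0 : (0 : ℝ) < N + 1 := by positivity
  have step : ∀ n : ℕ, n ≤ N + 1 →
      ∃ Y : ℝ → R, Y 0 = 1 ∧ IsContinuationOn f γ 0 (n / (N + 1)) Y := by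
    intro n
    induction n with
    | zero =>
      intro _
      obtain ⟨Φ, h1, h2⟩ := hloc 0 (by simp)
      refine ⟨fun s => Φ (γ s), h1, fun s hs => ⟨Φ, ?_, by simp⟩⟩
      have hs0 : s = 0 := by simpa using hs
      rw [hs0]
      exact Filter.eventually_of_mem (Metric.ball_mem_nhds _ (by positivity)) h2
    | succ n ih =>
      intro hn
      obtain ⟨Y, hY0, hY⟩ := ih (by omega)
      have hn1 : ((n : ℝ) + 1) / (N + 1) ≤ 1 := by
        rw [div_le_one hN0]
        exact_mod_cast hn
      have ha0 : (0 : ℝ) ≤ n / (N + 1) := by positivity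
      have hab : (n : ℝ) / (N + 1) ≤ (n + 1) / (N + 1) := by gcongr; linarith
      have ha : (n : ℝ) / (N + 1) ∈ Set.Icc (0 : ℝ) 1 := ⟨ha0, hab.trans hn1⟩
      obtain ⟨Φ, h1, h2⟩ := hloc _ ha
      push_cast
      -- Right multiplication by the value reached so far keeps a solution and matches it at the
      -- junction.
      refine ⟨_, ?_, hY.glue (Y₂ := fun s => Φ (γ s) * Y (n / (N + 1))) ?_ ha0 hab
        (by simp [h1]) hγ (hf.continuousOn.continuousAt (hW.mem_nhds (hγW _ ha)))⟩
      · simp [ha0, hY0]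
      · intro s hs
        refine ⟨fun z => Φ z * Y (n / (N + 1)), ?_, by simp⟩
        have hmem : γ s ∈ Metric.ball (γ (n / (N + 1))) (1 / M) := by
          refine hηγ s ⟨ha0.trans hs.1, hs.2.trans hn1⟩ _ ha ?_
          rw [Real.dist_eq, abs_of_nonneg (sub_nonneg.2 hs.1)]
          refine lt_of_le_of_lt ?_ hN
          have := hs.2
          rw [add_div] at this
          linarith
        filter_upwards [Metric.isOpen_ball.mem_nhds hmem] with z hz
        simpa [mul_assoc] using (h2 z hz).mul_const (Y (n / (N + 1)))
  obtain ⟨Y, hY0, hY⟩ := step (N + 1) le_rfl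
  refine ⟨Y, hY0, ?_⟩
  have : ((N + 1 : ℕ) : ℝ) / (N + 1) = 1 := by
    push_cast
    exact div_self hN0.ne'
  rwa [this] at hY

end Continuation

/-! ### Flat connections and gauge equivalence -/

section Gauge

variable {R : Type*} [NormedRing R] [NormedAlgebra ℂ R]

/-- Parallel transport in the direction of the parameter `τ` of a flat connection is a gauge
transformation between the restrictions of the connection to the fibres `τ = t₀` and `τ`. -/
theorem hasDerivAt_transport {Ω : ℂ → ℂ → R} {Ω' A : ℂ → R} {C : ℂ → ℂ → R} {t₀ z₀ : ℂ}
    {ε δ K L : ℝ} (hε : 0 < ε) (hδ : 0 < δ) (hK : 0 < K) (hL : 0 ≤ L)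
    (hΩ : ∀ z ∈ Metric.ball z₀ δ, ∀ τ ∈ Metric.ball t₀ ε, ‖Ω z τ‖ ≤ K)
    (hΩ₁ : ∀ z ∈ Metric.ball z₀ δ, ∀ τ ∈ Metric.ball t₀ ε, ‖Ω z τ - Ω z₀ τ‖ ≤ L * ‖z - z₀‖)
    (hΩ₂ : ∀ z ∈ Metric.ball z₀ δ, ∀ τ ∈ Metric.ball t₀ ε,
      ‖Ω z τ - Ω z₀ τ - (z - z₀) • Ω' τ‖ ≤ L * ‖z - z₀‖ ^ 2)
    (hC₀ : ∀ z ∈ Metric.ball z₀ δ, C z t₀ = 1)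
    (hC : ∀ z ∈ Metric.ball z₀ δ, ∀ τ ∈ Metric.ball t₀ ε, HasDerivAt (C z) (Ω z τ * C z τ) τ)
    (hA : ∀ τ ∈ Metric.ball t₀ ε, HasDerivAt A (Ω' τ + (Ω z₀ τ * A τ - A τ * Ω z₀ τ)) τ)
    {τ : ℂ} (hτ : τ ∈ Metric.ball t₀ ε) :
    HasDerivAt (fun z => C z τ) (A τ * C z₀ τ - C z₀ τ * A t₀) z₀ := by
  set G := (Real.exp (K * ε) - 1) / K with hG
  have hG0 : 0 ≤ G := div_nonneg (sub_nonneg.2 (Real.one_le_exp (by positivity))) hK.le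
  have hz₀ : z₀ ∈ Metric.ball z₀ δ := Metric.mem_ball_self hδ
  have ht₀ : t₀ ∈ Metric.ball t₀ ε := Metric.mem_ball_self hε
  have gron : ∀ {u u' : ℂ → R} {e : ℝ}, (∀ s ∈ Metric.ball t₀ ε, HasDerivAt u (u' s) s) →
      u t₀ = 0 → (∀ s ∈ Metric.ball t₀ ε, ‖u' s‖ ≤ K * ‖u s‖ + e) →
      ∀ s ∈ Metric.ball t₀ ε, ‖u s‖ ≤ e * G := fun h1 h2 h3 s hs =>
    norm_le_of_hasDerivAt_of_convex (convex_ball t₀ ε) ht₀ hK hε h1 h2 h3 hs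
      (mem_ball_iff_norm.1 hs).le
  set N := K * ‖(1 : R)‖ * G + ‖(1 : R)‖ with hN
  have hN0 : 0 ≤ N := by positivity
  have bound : ∀ s ∈ Metric.ball t₀ ε, ‖C z₀ s‖ ≤ N := by
    intro s hs
    have h := gron (u := fun s => C z₀ s - 1) (u' := fun s => Ω z₀ s * C z₀ s)
      (e := K * ‖(1 : R)‖) (fun s hs => (hC z₀ hz₀ s hs).sub_const 1) (by simp [hC₀ z₀ hz₀])
      (fun s hs => by
        calc ‖Ω z₀ s * C z₀ s‖ ≤ K * ‖(C z₀ s - 1) + 1‖ := by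
              rw [sub_add_cancel]
              exact (norm_mul_le _ _).trans (by gcongr; exact hΩ z₀ hz₀ s hs)
          _ ≤ K * (‖C z₀ s - 1‖ + ‖(1 : R)‖) := by gcongr; exact norm_add_le _ _
          _ = _ := by ring) s hs
    calc ‖C z₀ s‖ = ‖(C z₀ s - 1) + 1‖ := by rw [sub_add_cancel]
      _ ≤ ‖C z₀ s - 1‖ + ‖(1 : R)‖ := norm_add_le _ _
      _ ≤ N := by rw [hN]; gcongr
  have lip : ∀ z ∈ Metric.ball z₀ δ, ∀ s ∈ Metric.ball t₀ ε,
      ‖C z s - C z₀ s‖ ≤ L * ‖z - z₀‖ * N * G := by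
    intro z hz
    refine gron (u := fun s => C z s - C z₀ s) (u' := fun s => Ω z s * C z s - Ω z₀ s * C z₀ s)
      (fun s hs => (hC z hz s hs).sub (hC z₀ hz₀ s hs)) (by simp [hC₀ z₀ hz₀, hC₀ z hz])
      (fun s hs => ?_)
    have : Ω z s * C z s - Ω z₀ s * C z₀ s =
        Ω z s * (C z s - C z₀ s) + (Ω z s - Ω z₀ s) * C z₀ s := by noncomm_ring
    rw [this]
    refine (norm_add_le _ _).trans (add_le_add ?_ ?_)
    · exact (norm_mul_le _ _).trans (by gcongr; exact hΩ z hz s hs)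
    · exact (norm_mul_le _ _).trans
        (mul_le_mul (hΩ₁ z hz s hs) (bound s hs) (norm_nonneg _) (by positivity))
  -- Flatness shows that `D = A C - C A(t₀)` satisfies `D' = Ω D + Ω' C`, the equation expected of
  -- `∂C/∂z`, and `D(t₀) = 0`. So the remainder `C z - C z₀ - (z - z₀) D` solves a linear equation
  -- with forcing of order `‖z - z₀‖²`, and Grönwall bounds it without any prior regularity of `C`
  -- in `z`.
  have quad : ∀ z ∈ Metric.ball z₀ δ,
      ‖C z τ - C z₀ τ - (z - z₀) • (A τ * C z₀ τ - C z₀ τ * A t₀)‖ ≤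
        (L * N + L * (L * N * G)) * G * ‖z - z₀‖ ^ 2 := by
    intro z hz
    have h := gron (u := fun s => C z s - C z₀ s - (z - z₀) • (A s * C z₀ s - C z₀ s * A t₀))
      (u' := fun s => Ω z s * C z s - Ω z₀ s * C z₀ s -
        (z - z₀) • ((Ω' s + (Ω z₀ s * A s - A s * Ω z₀ s)) * C z₀ s + A s * (Ω z₀ s * C z₀ s)
          - Ω z₀ s * C z₀ s * A t₀))
      (e := L * ‖z - z₀‖ ^ 2 * N + L * ‖z - z₀‖ * (L * ‖z - z₀‖ * N * G))
      (fun s hs => ((hC z hz s hs).sub (hC z₀ hz₀ s hs)).sub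
        ((((hA s hs).mul (hC z₀ hz₀ s hs)).sub
          ((hC z₀ hz₀ s hs).mul_const (A t₀))).fun_const_smul (z - z₀)))
      (by simp [hC₀ z₀ hz₀, hC₀ z hz])
      (fun s hs => by
        have : Ω z s * C z s - Ω z₀ s * C z₀ s -
            (z - z₀) • ((Ω' s + (Ω z₀ s * A s - A s * Ω z₀ s)) * C z₀ s + A s * (Ω z₀ s * C z₀ s)
              - Ω z₀ s * C z₀ s * A t₀) =
            Ω z₀ s * (C z s - C z₀ s - (z - z₀) • (A s * C z₀ s - C z₀ s * A t₀)) +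
            ((Ω z s - Ω z₀ s - (z - z₀) • Ω' s) * C z₀ s +
              (Ω z s - Ω z₀ s) * (C z s - C z₀ s)) := by
          simp only [mul_sub, sub_mul, add_mul, mul_smul_comm, smul_mul_assoc, mul_assoc]
          module
        rw [this]
        refine (norm_add_le _ _).trans (add_le_add ?_ ((norm_add_le _ _).trans
          (add_le_add ?_ ?_)))
        · exact (norm_mul_le _ _).trans (by gcongr; exact hΩ z₀ hz₀ s hs)
        · exact (norm_mul_le _ _).trans
            (mul_le_mul (hΩ₂ z hz s hs) (bound s hs) (norm_nonneg _) (by positivity))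
        · exact (norm_mul_le _ _).trans
            (mul_le_mul (hΩ₁ z hz s hs) (lip z hz s hs) (norm_nonneg _) (by positivity))) τ hτ
    exact h.trans_eq (by ring)
  rw [hasDerivAt_iff_isLittleO]
  have hO : (fun z => C z τ - C z₀ τ - (z - z₀) • (A τ * C z₀ τ - C z₀ τ * A t₀)) =O[𝓝 z₀]
      fun z => (z - z₀) ^ 2 := by
    refine Asymptotics.IsBigO.of_bound ((L * N + L * (L * N * G)) * G) ?_
    filter_upwards [Metric.ball_mem_nhds z₀ hδ] with z hz
    simpa using quad z hz
  refine hO.trans_isLittleO ?_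
  have h0 : Filter.Tendsto (fun z : ℂ => z - z₀) (𝓝 z₀) (𝓝 0) := by
    simpa using (continuous_id.sub continuous_const).tendsto (X := ℂ) z₀ (f := fun z => z - z₀)
  exact (Asymptotics.isLittleO_pow_id (𝕜 := ℂ) one_lt_two).comp_tendsto h0

/-- The connections `d - A dz` and `d - A' dz` are related near every point of `S` by one gauge
transformation. -/
def GaugeEquivOn (S : Set ℂ) (A A' : ℂ → R) : Prop :=
  ∃ C : ℂ → R, ∀ z ∈ S, IsUnit (C z) ∧
    ∀ᶠ w in 𝓝 z, HasDerivAt C (A' w * C w - C w * A w) w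

theorem GaugeEquivOn.trans {S : Set ℂ} {A A' A'' : ℂ → R} (h : GaugeEquivOn S A A')
    (h' : GaugeEquivOn S A' A'') : GaugeEquivOn S A A'' := by
  obtain ⟨C, hC⟩ := h
  obtain ⟨C', hC'⟩ := h'
  refine ⟨fun z => C' z * C z, fun z hz => ⟨(hC' z hz).1.mul (hC z hz).1, ?_⟩⟩
  filter_upwards [(hC z hz).2, (hC' z hz).2] with w h1 h2
  refine (h2.mul h1).congr_deriv ?_
  noncomm_ring

theorem GaugeEquivOn.symm [CompleteSpace R] {S : Set ℂ} {A A' : ℂ → R}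
    (h : GaugeEquivOn S A A') : GaugeEquivOn S A' A := by
  obtain ⟨C, hC⟩ := h
  refine ⟨fun z => Ring.inverse (C z), fun z hz => ⟨(hC z hz).1.ringInverse, ?_⟩⟩
  have hcont : ContinuousAt C z := (hC z hz).2.self_of_nhds.continuousAt
  filter_upwards [(hC z hz).2, hcont.eventually (Units.isOpen.mem_nhds (hC z hz).1)] with w h1 h2
  obtain ⟨u, hu⟩ := h2
  have := (hasFDerivAt_ringInverse (𝕜 := ℂ) u)
  rw [hu] at this
  refine (this.comp_hasDerivAt w h1).congr_deriv ?_
  simp only [← hu, Ring.inverse_unit, neg_apply, ContinuousLinearMap.mulLeftRight_apply,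
    mul_sub, sub_mul]
  simp [mul_assoc]

/-- The matrix of a logarithmic connection with poles `0, t, 1`, with residues in any algebra. -/
noncomputable def logForm (B : Fin 3 → R) (t z : ℂ) : R :=
  (1 / z) • B 0 + (1 / (z - t)) • B 1 + (1 / (z - 1)) • B 2

/-- The flatness of the connection with components `logForm` and `K - B₂ / (z - t)`. -/
theorem hasDerivAt_logForm {B : ℂ → Fin 3 → R} {K : R} {t z : ℂ} (ht0 : t ≠ 0) (ht1 : t ≠ 1)
    (hz0 : z ≠ 0) (hz1 : z ≠ 1) (hzt : z ≠ t)
    (hB : ∀ i, HasDerivAt (fun s => B s i) (schlesingerField (B t) K t i) t) :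
    HasDerivAt (fun s => logForm (B s) s z)
      (((z - t) ^ 2)⁻¹ • B t 1 + ((K - (z - t)⁻¹ • B t 1) * logForm (B t) t z
        - logForm (B t) t z * (K - (z - t)⁻¹ • B t 1))) t := by
  have k1 := sub_ne_zero.2 ht1
  have k2 := sub_ne_zero.2 hz1
  have k3 := sub_ne_zero.2 hzt
  have d1 : HasDerivAt (fun s : ℂ => 1 / (z - s)) (1 / (z - t) ^ 2) t := by
    simpa using ((hasDerivAt_id' t).const_sub z).fun_inv k3
  refine ((((hB 0).const_smul (1 / z)).add (d1.smul (hB 1))).add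
    ((hB 2).const_smul (1 / (z - 1)))).congr_deriv ?_
  simp only [schlesingerField, logForm, mul_add, add_mul, mul_sub, sub_mul, mul_smul_comm,
    smul_mul_assoc, smul_add, smul_sub, smul_smul, Matrix.cons_val]
  match_scalars <;> field_simp <;> ring

end Gauge

/-! ### Gauge equivalence within a Schlesinger family -/

section Isomonodromy

variable {R : Type*} [NormedRing R] [NormedAlgebra ℂ R]

/-- Points outside `V` stay at a positive distance from `t₀`, so `Ω` is bounded uniformly in `z`,
even near `0`, `1` and `∞`. Hence the transports share one `t`-disc, on a smaller one of which they
are invertible, being within distance `1` of the identity. -/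
theorem eventually_gaugeEquivOn_logForm [CompleteSpace R] [NormOneClass R] {U : Set ℂ}
    (h0 : (0 : ℂ) ∉ U) (h1 : (1 : ℂ) ∉ U) {B : ℂ → Fin 3 → R} {K : ℂ → R}
    (hB : ∀ t ∈ U, ∀ i, HasDerivAt (fun s => B s i) (schlesingerField (B t) (K t) t i) t)
    (hK : DifferentiableOn ℂ K U) {V : Set ℂ} (hV : IsOpen V) (hVU : V ⊆ U) {t₀ : ℂ}
    (ht₀ : t₀ ∈ V) :
    ∀ᶠ t in 𝓝 t₀, GaugeEquivOn {z | z ∉ V ∧ z ≠ 0 ∧ z ≠ 1}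
      (logForm (B t₀) t₀) (logForm (B t) t) := by
  obtain ⟨e, he, heV⟩ := Metric.isOpen_iff.1 hV t₀ ht₀
  -- A radius strictly below `e` makes `d < ‖z - t₀‖` an open condition that holds near every point
  -- outside `V`.
  obtain ⟨d, hd, hde⟩ := exists_between he
  have hcU : Metric.closedBall t₀ d ⊆ U :=
    (Metric.closedBall_subset_ball hde).trans (heV.trans hVU)
  have hBd : DifferentiableOn ℂ (fun s => B s 1) U := fun t ht =>
    (hB t ht 1).differentiableAt.differentiableWithinAt
  obtain ⟨m₁, hm₁⟩ := (isCompact_closedBall t₀ d).exists_bound_of_continuousOn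
    (hBd.continuousOn.mono hcU)
  obtain ⟨m₂, hm₂⟩ := (isCompact_closedBall t₀ d).exists_bound_of_continuousOn
    (hK.continuousOn.mono hcU)
  have hm₁0 : 0 ≤ m₁ := (norm_nonneg _).trans (hm₁ t₀ (Metric.mem_closedBall_self hd.le))
  set Ω : ℂ → ℂ → R := fun z τ => K τ - (z - τ)⁻¹ • B τ 1 with hΩdef
  have hsub : Metric.ball t₀ (d / 2) ⊆ Metric.closedBall t₀ d :=
    Metric.ball_subset_closedBall.trans (Metric.closedBall_subset_closedBall (by linarith))
  have hdist : ∀ z, d < ‖z - t₀‖ → ∀ τ ∈ Metric.ball t₀ (d / 2), d / 2 ≤ ‖z - τ‖ := by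
    intro z hz τ hτ
    have h := mem_ball_iff_norm.1 hτ
    have : ‖z - t₀‖ ≤ ‖z - τ‖ + ‖τ - t₀‖ := by
      simpa using norm_add_le (z - τ) (τ - t₀)
    linarith
  have hne : ∀ z, d < ‖z - t₀‖ → ∀ τ ∈ Metric.ball t₀ (d / 2), z - τ ≠ 0 := fun z hz τ hτ =>
    norm_pos_iff.1 (lt_of_lt_of_le (by positivity) (hdist z hz τ hτ))
  have hinv : ∀ z, d < ‖z - t₀‖ → ∀ τ ∈ Metric.ball t₀ (d / 2), ‖(z - τ)⁻¹‖ ≤ 2 / d := by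
    intro z hz τ hτ
    rw [norm_inv, ← inv_div]
    exact inv_anti₀ (by positivity) (hdist z hz τ hτ)
  set M := max (m₂ + 2 / d * m₁) (1 / (d / 4)) with hM
  have hM0 : 0 < M := lt_max_of_lt_right (by positivity)
  have hΩM : ∀ z, d < ‖z - t₀‖ → ∀ τ ∈ Metric.ball t₀ (d / 2), ‖Ω z τ‖ ≤ M := by
    intro z hz τ hτ
    refine ((norm_sub_le _ _).trans (add_le_add (hm₂ τ (hsub hτ)) ?_)).trans (le_max_left _ _)
    rw [norm_smul]
    exact mul_le_mul (hinv z hz τ hτ) (hm₁ τ (hsub hτ)) (norm_nonneg _) (by positivity)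
  have hex : ∀ z, ∃ Φ : ℂ → R, d < ‖z - t₀‖ → Φ t₀ = 1 ∧
      (∀ τ ∈ Metric.ball t₀ (1 / M), HasDerivAt Φ (Ω z τ * Φ τ) τ) ∧
      ∀ τ ∈ Metric.ball t₀ (1 / (3 * M)), ‖Φ τ - 1‖ < 1 := by
    intro z
    by_cases hz : d < ‖z - t₀‖
    · have h2 : 2 * (d / 4) = d / 2 := by ring
      obtain ⟨Φ, hΦ⟩ := exists_linearODE_solution (f := Ω z) (c := t₀) (r := d / 4) (M := M)
        (by positivity) (le_max_right _ _) (by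
          rw [h2]
          refine (hK.mono (hsub.trans hcU)).sub (DifferentiableOn.fun_smul ?_
            (hBd.mono (hsub.trans hcU)))
          exact ((differentiableOn_const z).sub differentiableOn_id).inv (hne z hz))
        (by rw [h2]; exact hΩM z hz)
      exact ⟨Φ, fun _ => hΦ⟩
    · exact ⟨0, fun h => absurd h hz⟩
  -- The choice is made separately for each `z`; differentiability in `z` comes only from
  -- `hasDerivAt_transport`.
  choose C hC using hex
  have hMd : 1 / M ≤ d / 2 := by
    have : 1 / M ≤ d / 4 := by
      rw [div_le_iff₀ hM0, mul_comm]
      exact (div_le_iff₀ (by positivity)).1 (le_max_right _ _)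
    linarith
  have hball : Metric.ball t₀ (1 / M) ⊆ Metric.ball t₀ (d / 2) := Metric.ball_subset_ball hMd
  have hopen : IsOpen {z : ℂ | d < ‖z - t₀‖} := isOpen_lt (by fun_prop) (by fun_prop)
  filter_upwards [Metric.ball_mem_nhds t₀ (show 0 < 1 / (3 * M) by positivity)] with t ht
  have htM : t ∈ Metric.ball t₀ (1 / M) :=
    Metric.ball_subset_ball (by gcongr; linarith) ht
  refine ⟨fun z => C z t, fun z ⟨hzV, hz0, hz1⟩ => ?_⟩
  have hzd : d < ‖z - t₀‖ := by
    by_contra! h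
    exact hzV (heV (mem_ball_iff_norm.2 (h.trans_lt hde)))
  constructor
  · have := (isUnit_one_sub_of_norm_lt_one (x := 1 - C z t)
      (by rw [norm_sub_rev]; exact (hC z hzd).2.2 t ht))
    simpa using this
  · filter_upwards [hopen.mem_nhds hzd, isOpen_ne.mem_nhds hz0, isOpen_ne.mem_nhds hz1]
      with w hwd hw0 hw1
    obtain ⟨δ, hδ, hδw⟩ := Metric.isOpen_iff.1 hopen w hwd
    -- `L` adds the constants of the first and second order estimates of `(z - τ)⁻¹`, whose norm is
    -- at most `2 / d`.
    refine hasDerivAt_transport (Ω := Ω) (Ω' := fun τ => ((w - τ) ^ 2)⁻¹ • B τ 1)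
      (A := fun τ => logForm (B τ) τ w) (C := C) (ε := 1 / M) (δ := δ) (K := M)
      (L := (2 / d) ^ 2 * m₁ + (2 / d) ^ 3 * m₁) (by positivity) hδ hM0 (by positivity)
      (fun v hv τ hτ => hΩM v (hδw hv) τ (hball hτ)) (fun v hv τ hτ => ?_) (fun v hv τ hτ => ?_)
      (fun v hv => (hC v (hδw hv)).1) (fun v hv τ hτ => (hC v (hδw hv)).2.1 τ hτ)
      (fun τ hτ => ?_) htM
    · have n1 := hne v (hδw hv) τ (hball hτ)
      have n2 := hne w hwd τ (hball hτ)
      have : Ω v τ - Ω w τ = ((v - w) * ((v - τ)⁻¹ * (w - τ)⁻¹)) • B τ 1 := by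
        simp only [hΩdef]
        match_scalars <;> field_simp <;> ring
      rw [this, norm_smul, norm_mul, norm_mul]
      calc ‖v - w‖ * (‖(v - τ)⁻¹‖ * ‖(w - τ)⁻¹‖) * ‖B τ 1‖
          ≤ ‖v - w‖ * ((2 / d) * (2 / d)) * m₁ := by
            gcongr
            · exact hinv v (hδw hv) τ (hball hτ)
            · exact hinv w hwd τ (hball hτ)
            · exact hm₁ τ (hsub (hball hτ))
        _ = ((2 / d) ^ 2 * m₁ + 0) * ‖v - w‖ := by ring
        _ ≤ _ := by gcongr; positivity
    · have n1 := hne v (hδw hv) τ (hball hτ)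
      have n2 := hne w hwd τ (hball hτ)
      have : Ω v τ - Ω w τ - (v - w) • ((w - τ) ^ 2)⁻¹ • B τ 1 =
          -(((v - w) ^ 2 * ((v - τ)⁻¹ * ((w - τ)⁻¹ * (w - τ)⁻¹))) • B τ 1) := by
        simp only [hΩdef]
        match_scalars <;> field_simp <;> ring
      rw [this, norm_neg, norm_smul, norm_mul, norm_mul, norm_mul, norm_pow]
      calc ‖v - w‖ ^ 2 * (‖(v - τ)⁻¹‖ * (‖(w - τ)⁻¹‖ * ‖(w - τ)⁻¹‖)) * ‖B τ 1‖
          ≤ ‖v - w‖ ^ 2 * ((2 / d) * ((2 / d) * (2 / d))) * m₁ := by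
            gcongr
            · exact hinv v (hδw hv) τ (hball hτ)
            · exact hinv w hwd τ (hball hτ)
            · exact hinv w hwd τ (hball hτ)
            · exact hm₁ τ (hsub (hball hτ))
        _ = (0 + (2 / d) ^ 3 * m₁) * ‖v - w‖ ^ 2 := by ring
        _ ≤ _ := by gcongr; positivity
    · have hτU : τ ∈ U := hcU (hsub (hball hτ))
      exact hasDerivAt_logForm (K := K τ) (fun h => h0 (h ▸ hτU)) (fun h => h1 (h ▸ hτU)) hw0 hw1
        (sub_ne_zero.1 (hne w hwd τ (hball hτ))) (hB τ hτU)

/-- The connections of a Schlesinger family are gauge equivalent away from a connected open set of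
parameters. -/
theorem gaugeEquivOn_logForm [CompleteSpace R] [NormOneClass R] {U : Set ℂ}
    (h0 : (0 : ℂ) ∉ U) (h1 : (1 : ℂ) ∉ U) {B : ℂ → Fin 3 → R} {K : ℂ → R}
    (hB : ∀ t ∈ U, ∀ i, HasDerivAt (fun s => B s i) (schlesingerField (B t) (K t) t i) t)
    (hK : DifferentiableOn ℂ K U) {V : Set ℂ} (hV : IsOpen V) (hVc : IsPreconnected V)
    (hVU : V ⊆ U) {t t' : ℂ} (ht : t ∈ V) (ht' : t' ∈ V) :
    GaugeEquivOn {z | z ∉ V ∧ z ≠ 0 ∧ z ≠ 1} (logForm (B t) t) (logForm (B t') t') := by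
  refine hVc.induction₂' (fun t t' => GaugeEquivOn {z | z ∉ V ∧ z ≠ 0 ∧ z ≠ 1}
    (logForm (B t) t) (logForm (B t') t')) (fun s hs => ?_) ?_ ht ht'
  · refine eventually_nhdsWithin_of_eventually_nhds ?_
    filter_upwards [eventually_gaugeEquivOn_logForm h0 h1 hB hK hV hVU hs] with s' h
    exact ⟨h, h.symm⟩
  · intro a b c _ _ _ hab hbc
    exact hab.trans hbc

end Isomonodromy

/-! ### Monodromy of the matrix connections -/

open scoped Matrix.Norms.Operator in
theorem hasDerivAt_matrix_iff {Φ : ℂ → Matrix (Fin 3) (Fin 3) ℂ} {D : Matrix (Fin 3) (Fin 3) ℂ}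
    {z : ℂ} : HasDerivAt Φ D z ↔ ∀ i j, HasDerivAt (fun w => Φ w i j) (D i j) z :=
  hasDerivAt_pi.trans (forall_congr' fun _ => hasDerivAt_pi)

-- If `Φ' = A Φ` and `C' = A' C - C A`, then `(C Φ)' = A' (C Φ)`. The constant `D` serves to
-- renormalise at the base point.
open scoped Matrix.Norms.Operator in
theorem IsContinuation.gauge {A A' : ℂ → Matrix (Fin 3) (Fin 3) ℂ} {S : Set ℂ}
    {C : ℂ → Matrix (Fin 3) (Fin 3) ℂ}
    (hC : ∀ z ∈ S, ∀ᶠ w in 𝓝 z, HasDerivAt C (A' w * C w - C w * A w) w)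
    {z₀ z₁ : ℂ} {γ : Path z₀ z₁} (hγ : ∀ s, γ s ∈ S)
    {Y : unitInterval → Matrix (Fin 3) (Fin 3) ℂ} (hY : IsContinuation A γ Y)
    (D : Matrix (Fin 3) (Fin 3) ℂ) :
    IsContinuation A' γ (fun s => C (γ s) * Y s * D) := by
  intro s
  obtain ⟨Φ, hΦ, hΦY⟩ := hY s
  refine ⟨fun z => C z * Φ z * D, ?_, hΦY.mono fun s' h => by simp only [h]⟩
  filter_upwards [hΦ, hC _ (hγ s)] with w h1 h2
  refine hasDerivAt_matrix_iff.1
    (((h2.mul (hasDerivAt_matrix_iff.2 h1)).mul_const D).congr_deriv ?_)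
  noncomm_ring

open scoped Matrix.Norms.Operator in
theorem exists_isContinuation {A : ℂ → Matrix (Fin 3) (Fin 3) ℂ} {W : Set ℂ} (hW : IsOpen W)
    (hA : DifferentiableOn ℂ A W) {z₀ z₁ : ℂ} (γ : Path z₀ z₁) (hγ : ∀ s, γ s ∈ W) :
    ∃ Y : unitInterval → Matrix (Fin 3) (Fin 3) ℂ, IsContinuation A γ Y ∧ Y 0 = 1 := by
  obtain ⟨Y, hY0, hY⟩ := exists_isContinuationOn hW hA γ.continuous_extend
    (fun s hs => by rw [γ.extend_apply hs]; exact hγ _)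
  refine ⟨fun s => Y s, fun s => ?_, hY0⟩
  obtain ⟨Φ, hΦ, hΦY⟩ := hY s s.2
  rw [γ.extend_apply s.2] at hΦ
  refine ⟨Φ, hΦ.mono fun z h => hasDerivAt_matrix_iff.1 h, ?_⟩
  have ht : Filter.Tendsto (fun s : unitInterval => (s : ℝ)) (𝓝 s) (𝓝[Set.Icc 0 1] (s : ℝ)) :=
    tendsto_nhdsWithin_iff.2 ⟨continuous_subtype_val.tendsto s, .of_forall fun s => s.2⟩
  filter_upwards [ht.eventually hΦY] with s' h
  rw [h, γ.extend_apply s'.2]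

open scoped Matrix.Norms.Operator in
/-- A family of residues solving the Schlesinger equations in some gauge is isomonodromic. -/
theorem isIsomonodromic_of_schlesinger {U : Set ℂ} (h0 : (0 : ℂ) ∉ U) (h1 : (1 : ℂ) ∉ U)
    {B : ℂ → Fin 3 → Matrix (Fin 3) (Fin 3) ℂ} {K : ℂ → Matrix (Fin 3) (Fin 3) ℂ}
    (hB : ∀ t ∈ U, ∀ i, HasDerivAt (fun s => B s i) (schlesingerField (B t) (K t) t i) t)
    (hK : DifferentiableOn ℂ K U) : IsIsomonodromic U B := by
  intro c r hVU t ht t' ht' z₀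
  obtain ⟨C, hC⟩ := gaugeEquivOn_logForm h0 h1 hB hK Metric.isOpen_ball
    (convex_ball c r).isPreconnected hVU ht ht'
  by_cases hz₀ : z₀ ∉ Metric.ball c r ∧ z₀ ≠ 0 ∧ z₀ ≠ 1
  · obtain ⟨u, hu⟩ := (hC z₀ hz₀).1
    -- The conjugator is `C z₀`: the continuation `C Y (C z₀)⁻¹` starts at `1` and, as `C` is
    -- single-valued, ends at `C z₀ * Y 1 * (C z₀)⁻¹`.
    refine ⟨u, fun γ hγ => ?_⟩
    have hW : IsOpen {z : ℂ | z ≠ 0 ∧ z ≠ t ∧ z ≠ 1} :=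
      isOpen_ne.inter (isOpen_ne.inter isOpen_ne)
    have hA : DifferentiableOn ℂ (logMatrix (B t) t) {z : ℂ | z ≠ 0 ∧ z ≠ t ∧ z ≠ 1} := by
      intro z hz
      have e0 : z ≠ 0 := hz.1
      have e1 : z - t ≠ 0 := sub_ne_zero.2 hz.2.1
      have e2 : z - 1 ≠ 0 := sub_ne_zero.2 hz.2.2
      refine DifferentiableAt.differentiableWithinAt ?_
      unfold logMatrix
      fun_prop (disch := assumption)
    obtain ⟨Y, hY, hY0⟩ := exists_isContinuation hW hA γ
      (fun s => ⟨(hγ s).2.1, fun h => (hγ s).1 (h ▸ ht), (hγ s).2.2⟩)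
    refine ⟨Y 1, ⟨Y, hY, hY0, rfl⟩, _, hY.gauge (A' := logMatrix (B t') t')
      (fun z hz => (hC z hz).2) hγ
      ((u⁻¹ : GL (Fin 3) ℂ) : Matrix (Fin 3) (Fin 3) ℂ), ?_, ?_⟩
    · simp [hY0, ← hu]
    · simp [hu]
  -- No admissible loop starts at an excluded base point.
  · exact ⟨1, fun γ hγ => absurd (γ.source ▸ hγ 0) hz₀⟩

open scoped Matrix.Norms.Operator in
theorem isIsomonodromic_residueFamily (lam mu : Fin 3 → ℂ) (hsum : ∑ i, lam i = ∑ i, mu i)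
    {U : Set ℂ} (hU : IsOpen U) (h0 : (0 : ℂ) ∉ U) (h1 : (1 : ℂ) ∉ U)
    {y : ℂ → ℂ} (hy : SolvesPVI (pviParam lam mu) U y) :
    IsIsomonodromic U (residueFamily lam mu y) := by
  have hB := fun t (ht : t ∈ U) => hasDerivAt_residueFamily lam mu hsum hU h0 h1 hy ht
  refine isIsomonodromic_of_schlesinger h0 h1
    (K := fun t => gaugeMatrix (residueFamily lam mu y t) t)
    (fun t ht i => hasDerivAt_matrix_iff.2 (hB t ht i)) fun t ht => ?_
  have ht0 : t ≠ 0 := fun h => h0 (h ▸ ht)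
  have ht1 : t - 1 ≠ 0 := sub_ne_zero.2 fun h => h1 (h ▸ ht)
  have dB := fun i j k => (hB t ht i j k).differentiableAt
  refine DifferentiableAt.differentiableWithinAt ?_
  refine differentiableAt_pi.2 fun j => differentiableAt_pi.2 fun k => ?_
  fin_cases j <;> fin_cases k <;> simp [gaugeMatrix] <;> fun_prop (disch := assumption)

theorem theorem2 (lam mu : Fin 3 → ℂ) (hsum : ∑ i, lam i = ∑ i, mu i)
    (U : Set ℂ) (hU : IsOpen U) (h0 : (0 : ℂ) ∉ U) (h1 : (1 : ℂ) ∉ U)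
    (y : ℂ → ℂ) (hy : SolvesPVI (pviParam lam mu) U y) :
    (∀ t ∈ U,
      (∀ i, (residueFamily lam mu y t i).rank ≤ 1 ∧
        (lam i ≠ 0 ∨ mu 2 ≠ 0 → (residueFamily lam mu y t i).rank = 1) ∧
        (residueFamily lam mu y t i).trace = lam i) ∧
      (∑ i, residueFamily lam mu y t i).charpoly =
        ∏ i, (Polynomial.X - Polynomial.C (mu i))) ∧
    IsIsomonodromic U (residueFamily lam mu y) := by
  refine ⟨fun t ht => ?_, isIsomonodromic_residueFamily lam mu hsum hU h0 h1 hy⟩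
  obtain ⟨hy0, hy1, hyt, -⟩ := hy.2 t ht
  have ht0 : t ≠ 0 := fun h => h0 (h ▸ ht)
  have ht1 : t ≠ 1 := fun h => h1 (h ▸ ht)
  simp only [residueFamily, residues_eq_rowParts, sum_rowParts, trace_rowParts]
  refine ⟨fun i => ⟨rank_rowParts_le_one _ i, fun h => ?_, ?_⟩,
    charpoly_residueSum lam mu hsum ht0 ht1⟩
  · obtain ⟨k, hk⟩ := exists_residueSum_ne_zero lam mu hsum ht0 ht1 hy0 hy1 hyt h
    exact rank_rowParts_eq_one hk
  · fin_cases i <;> simp [residueSum]
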